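/- Let $N\ge 1$, let $f_1,\dots,f_N:\mathbb R^n\to\mathbb R$ be differentiable with $\nabla f_i$ Lipschitz continuous with modulus $L_{f_i}\ge 0$, and let $g:\mathbb R^n\to\mathbb R\cup\{\infty\}$ be proper, convex and lower semicontinuous. Let $\varphi(x)=\frac1N\sum_{i=1}^N f_i(x)+g(x)$. Denote by $\hat\partial h$ and $\partial h$ the regular (Fréchet) and the limiting subdifferential of a proper lsc function $h$. For $\theta\in(0,1)$, $h$ has the KL property with exponent $\theta$ if for every $\bar w$ with $\partial h(\bar w)\neq\emptyset$ there are $\varepsilon,\eta,\varrho>0$ such that, with $\psi(s)=\varrho s^{1-\theta}$, $$\psi'\bigl(h(w)-h(\bar w)\bigr)\,\mathrm{dist}\bigl(0,\partial h(w)\bigr)\ge 1$$ for all $w$ with $\|w-\bar w\|<\varepsilon$ and $h(\bar w)<h(w)<h(\bar w)+\eta$ (where $\mathrm{dist}(0,\emptyset)=\infty$). Consider the nonconvex proximal Finito/MISO algorithm: choose $x^{\rm init}\in\mathbb R^n$ and stepsizes $\gamma_i\in(0,N/L_{f_i})$ (with $N/0=\infty$), put $\hat\gamma=\bigl(\sum_{i=1}^N\gamma_i^{-1}\bigr)^{-1}$,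 $s_i^0=x^{\rm init}-\frac{\gamma_i}{N}\nabla f_i(x^{\rm init})$ and $\hat s^0=\hat\gamma\sum_{i=1}^N\gamma_i^{-1}s_i^0$, and for $k=0,1,2,\dots$ select $I^{k+1}\subseteq\{1,\dots,N\}$, compute $$z^k\in\operatorname{prox}_{\hat\gamma g}(\hat s^k)=\operatorname*{arg\,min}_{w\in\mathbb R^n}\Bigl\{g(w)+\tfrac1{2\hat\gamma}\|w-\hat s^k\|^2\Bigr\},$$ and set $s_i^{k+1}=z^k-\frac{\gamma_i}{N}\nabla f_i(z^k)$ for $i\in I^{k+1}$, $s_i^{k+1}=s_i^k$ for $i\notin I^{k+1}$, and $\hat s^{k+1}=\hat s^k+\sum_{i\in I^{k+1}}\frac{\hat\gamma}{\gamma_i}(s_i^{k+1}-s_i^k)$. Suppose that the sampling is essentially cyclic: there is $T\ge 1$ such that each index belongs to at least one of any $T$ consecutive sets $I^{k+1},\dots,I^{k+T}$. Suppose that $\varphi$ is coercive (that is, $\varphi(x)\to\infty$ as $\|x\|\to\infty$) and has the KL property with exponent $\theta\in(0,1)$. Then (surely, i.e. for every such choice of the sets $I^{k}$) the sequence $(z^k)_{k\in\mathbb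 N}$ converges to a stationary point $z^\star$ of $\varphi$, i.e. $0\in\hat\partial\varphi(z^\star)$. Moreover, if $\theta\le\frac12$, then it converges at $R$-linear rate: there are $C\ge 0$ and $\rho\in(0,1)$ with $\|z^k-z^\star\|\le C\rho^k$ for all $k\in\mathbb N$. -/

import Mathlib

open Filter Topology
open scoped NNReal

/-- `h : E → ℝ ∪ {∞}` is proper: it never takes the value `-∞` and is finite somewhere. -/
def ProperFun {E : Type*} (h : E → EReal) : Prop :=
  (∀ x, h x ≠ ⊥) ∧ ∃ x, h x ≠ ⊤

/-- Convexity of a proper extended-real-valued function (here `0 * ⊤ = 0` in `EReal`, so the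
inequality is trivial when one of the weights vanishes). -/
def ConvexFun {E : Type*} [AddCommGroup E] [Module ℝ E] (h : E → EReal) : Prop :=
  ∀ (x y : E) (a b : ℝ), 0 ≤ a → 0 ≤ b → a + b = 1 →
    h (a • x + b • y) ≤ (a : EReal) * h x + (b : EReal) * h y

/-- Coercivity: `h x → ∞` as `‖x‖ → ∞`. -/
def CoerciveFun {E : Type*} [NormedAddCommGroup E] (h : E → EReal) : Prop :=
  Tendsto h (comap (fun x : E => ‖x‖) atTop) (𝓝 ⊤)

/-- The regular (Fréchet) subdifferential: `v` belongs to it at `x` iff `h x` is finite and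
`h w ≥ h x + ⟪v, w - x⟫ + o(‖w - x‖)` as `w → x`. -/
def regularSubdiff {E : Type*} [NormedAddCommGroup E] [InnerProductSpace ℝ E]
    (h : E → EReal) (x : E) : Set E :=
  {v | h x ≠ ⊤ ∧ h x ≠ ⊥ ∧ ∀ ε : ℝ, 0 < ε → ∀ᶠ w in 𝓝 x,
    h x + ((inner ℝ v (w - x) - ε * ‖w - x‖ : ℝ) : EReal) ≤ h w}

/-- The (limiting) subdifferential `∂h`: limits of regular subgradients `v k` at points `y k → x`
with `h (y k) → h x`, at points `x` where `h` is finite. -/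
def subdiff {E : Type*} [NormedAddCommGroup E] [InnerProductSpace ℝ E]
    (h : E → EReal) (x : E) : Set E :=
  {v | h x ≠ ⊤ ∧ h x ≠ ⊥ ∧ ∃ (y : ℕ → E) (u : ℕ → E),
    Tendsto y atTop (𝓝 x) ∧ Tendsto (fun k => h (y k)) atTop (𝓝 (h x)) ∧
    (∀ k, u k ∈ regularSubdiff h (y k)) ∧ Tendsto u atTop (𝓝 v)}

/-- `x` is stationary for `h`: `0` is a regular subgradient of `h` at `x`. -/
def IsStationaryPoint {E : Type*} [NormedAddCommGroup E] [InnerProductSpace ℝ E]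
    (h : E → EReal) (x : E) : Prop :=
  0 ∈ regularSubdiff h x

/-- The desingularizing function `ψ(s) = ϱ s ^ (1 - θ)`. -/
noncomputable def desing (ϱ θ : ℝ) (s : ℝ) : ℝ := ϱ * s ^ (1 - θ)

/-- The KL property with exponent `θ` at a point `wbar` of the domain of `h`:
`ψ'(h w - h wbar) * dist (0, ∂h w) ≥ 1` for all `w` near `wbar` with
`h wbar < h w < h wbar + η`.  The distance takes values in `[0, ∞]`, and it is `∞` if `∂h w = ∅`. -/
def HasKLAt {E : Type*} [NormedAddCommGroup E] [InnerProductSpace ℝ E]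
    (h : E → EReal) (θ : ℝ) (wbar : E) : Prop :=
  ∃ ε η ϱ : ℝ, 0 < ε ∧ 0 < η ∧ 0 < ϱ ∧
    ∀ w : E, ‖w - wbar‖ < ε → h wbar < h w → h w < h wbar + (η : EReal) →
      1 ≤ ENNReal.ofReal (deriv (desing ϱ θ) ((h w).toReal - (h wbar).toReal))
            * Metric.infEDist 0 (subdiff h w)

/-- The KL property with exponent `θ`: it holds at every point of `dom ∂h`. -/
def HasKL {E : Type*} [NormedAddCommGroup E] [InnerProductSpace ℝ E]
    (h : E → EReal) (θ : ℝ) : Prop :=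
  ∀ wbar : E, (subdiff h wbar).Nonempty → HasKLAt h θ wbar

/-- The proximal mapping `prox_{t h}(x) = argmin_w { h w + ‖w - x‖² / (2 t) }`, set-valued. -/
def prox {E : Type*} [NormedAddCommGroup E] (t : ℝ) (h : E → EReal) (x : E) : Set E :=
  {u | ∀ w : E, h u + ((‖u - x‖ ^ 2 / (2 * t) : ℝ) : EReal)
        ≤ h w + ((‖w - x‖ ^ 2 / (2 * t) : ℝ) : EReal)}

/-- The finite-sum cost `φ x = (1/N) ∑ i, f i x + g x`. -/
noncomputable def finiteSumCost {E : Type*} {N : ℕ} (f : Fin N → E → ℝ) (g : E → EReal)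
    (x : E) : EReal :=
  (((1 / (N : ℝ)) * ∑ i, f i x : ℝ) : EReal) + g x

/-- `γhat = (∑ i, 1 / γ i)⁻¹`. -/
noncomputable def gammaHat {N : ℕ} (γ : Fin N → ℝ) : ℝ := (∑ i, (γ i)⁻¹)⁻¹

/-- The forward step `x - (γ i / N) ∇f i x`. -/
noncomputable def forwardStep {N n : ℕ} (f : Fin N → EuclideanSpace ℝ (Fin n) → ℝ)
    (γ : Fin N → ℝ) (i : Fin N) (x : EuclideanSpace ℝ (Fin n)) : EuclideanSpace ℝ (Fin n) :=
  x - (γ i / (N : ℝ)) • gradient (f i) x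

/-- `s k`, `shat k` are the values of the variables of the nonconvex proximal Finito/MISO algorithm
at the beginning of iteration `k`; `I k` is the set of indices selected at iteration `k` and
`z k ∈ prox_{γhat g}(shat k)` the point computed there.  The inner loop over `i ∈ I k` performs
`v ← z - (γ i / N) ∇f i z`, `shat ← shat + (γhat / γ i) (v - s i)`, `s i ← v`; each
pass touches only `s i` and `shat`, so that its outcome is the one stated in `s_succ` and
`shat_succ`, in whatever order the indices are processed. -/
structure IsFinitoRun {N n : ℕ} (f : Fin N → EuclideanSpace ℝ (Fin n) → ℝ)
    (g : EuclideanSpace ℝ (Fin n) → EReal) (γ : Fin N → ℝ)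
    (xinit : EuclideanSpace ℝ (Fin n)) (I : ℕ → Finset (Fin N))
    (s : ℕ → Fin N → EuclideanSpace ℝ (Fin n))
    (shat z : ℕ → EuclideanSpace ℝ (Fin n)) : Prop where
  s_zero : ∀ i, s 0 i = forwardStep f γ i xinit
  shat_zero : shat 0 = gammaHat γ • ∑ i, (γ i)⁻¹ • s 0 i
  z_mem : ∀ k, z k ∈ prox (gammaHat γ) g (shat k)
  s_succ : ∀ k i, s (k + 1) i = if i ∈ I k then forwardStep f γ i (z k) else s k i
  shat_succ : ∀ k, shat (k + 1) =
    shat k + ∑ i ∈ I k, (gammaHat γ / γ i) • (forwardStep f γ i (z k) - s k i)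

/-- Essentially cyclic sampling: for some `T ≥ 1`, every index is selected at least once within any
`T` consecutive iterations. -/
def EssentiallyCyclic {N : ℕ} (I : ℕ → Finset (Fin N)) : Prop :=
  ∃ T : ℕ, 1 ≤ T ∧ ∀ (i : Fin N) (k : ℕ), ∃ j, k ≤ j ∧ j < k + T ∧ i ∈ I j

/-- `R`-linear convergence of `z` to `zstar`. -/
def RLinearConvergence {E : Type*} [NormedAddCommGroup E] (z : ℕ → E) (zstar : E) : Prop :=
  ∃ C ρ : ℝ, 0 ≤ C ∧ 0 < ρ ∧ ρ < 1 ∧ ∀ k, ‖z k - zstar‖ ≤ C * ρ ^ k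

/-!
Write `x k i` for the point at which the gradient of `f i` was last evaluated before iteration `k`.
Completing squares (`surrogate_sub_surrogate`) shows that `z k` minimizes `g + surrogate (x k)`,
where the surrogate linearizes each `f i` at `x k i` and adds the term `‖w - x k i‖² / (2 γ i)`.
The minimal value `V k` (`lyapunov`) serves as Lyapunov function: as `g` is convex the minimum has
quadratic growth, and by the stepsize restriction each model majorizes `f i / N`, so that
`V (k + 1) + c ‖z (k + 1) - z k‖² ≤ V k` (`IsFinitoRun.lyapunov_succ_add_sq_le`) and
`φ (z k) ≤ V k`.
Coercivity then keeps the iterates bounded and `V` bounded below; hence `V` converges, the steps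
tend to `0`, and every cluster point is stationary with cost `lim V`
(`isStationaryPoint_of_tendsto`).

Under essentially cyclic sampling, from iteration `T` on every `x k i` is one of the last `T`
iterates, so `‖z k - x k i‖` is at most the sum `δ` of the lengths of the last `T` steps
(`norm_sub_lastEval_le`). Thus
`V k - φ (z k) = O(δ²)`, and `φ` has a regular subgradient of norm `O(δ)` at `z k`
(`surrogateResidual_mem_regularSubdiff`, `norm_surrogateResidual_le`). There is therefore no need
to transfer the KL property to a lifted function: applied to `φ` itself near each cluster point, it
gives `(V k - lim V) ^ max θ (1 / 2) = O(δ)` (`rpow_max_half_le`), uniformly by compactness.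

What remains concerns real sequences. Concavity of `t ↦ t ^ (1 - σ)` and the delayed inequality
give `δ (k + T) ≤ (δ k + w k) / 2` with `w` summable, whence the steps are summable
(`summable_of_decrease_of_rpow_le`). If `θ ≤ 1 / 2`, the exponent is `1 / 2` and `V - lim V`
contracts by a fixed factor every `T` iterations, whence the steps decay geometrically
(`exists_geometric_bound_of_decrease_of_sqrt_le`).
-/

/-! ### Real sequences with a delayed Łojasiewicz inequality -/

/-- A division-free form of the concavity of `t ↦ t ^ a`, valid also at `x = 0`. -/
lemma mul_sub_le_rpow_mul_rpow_sub {a x y : ℝ} (ha0 : 0 ≤ a) (ha1 : a ≤ 1) (hx : 0 ≤ x)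
    (hy : 0 ≤ y) : a * (x - y) ≤ x ^ (1 - a) * (x ^ a - y ^ a) := by
  have h := Real.geom_mean_le_arith_mean2_weighted (sub_nonneg.2 ha1) ha0 hx hy (by ring)
  have h2 : x ^ (1 - a) * x ^ a = x := by
    rw [← Real.rpow_add_of_nonneg hx (sub_nonneg.2 ha1) ha0]; simp
  rw [mul_sub (x ^ (1 - a)), h2]
  linarith

lemma sum_range_sub_succ_add (E : ℕ → ℝ) (k T : ℕ) :
    ∑ j ∈ Finset.range T, (E (k + j) - E (k + j + 1)) = E k - E (k + T) := by
  induction T with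
  | zero => simp
  | succ T ih => rw [Finset.sum_range_succ, ih, ← add_assoc]; ring

lemma summable_of_add_le_half {T : ℕ} {u w : ℕ → ℝ} (hu : ∀ k, 0 ≤ u k) (hw : ∀ k, 0 ≤ w k)
    (hws : Summable w) (h : ∀ k, u (k + T) ≤ (u k + w k) / 2) : Summable u := by
  refine summable_of_sum_range_le (c := 2 * ∑ i ∈ Finset.range T, u i + ∑' k, w k) hu fun n => ?_
  have h1 : ∑ i ∈ Finset.range n, u i ≤ ∑ i ∈ Finset.range (T + n), u i :=
    Finset.sum_le_sum_of_subset_of_nonneg (Finset.range_mono (by omega)) fun i _ _ => hu i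
  have h2 : ∑ i ∈ Finset.range n, u (T + i) ≤ ∑ i ∈ Finset.range n, (u i + w i) / 2 :=
    Finset.sum_le_sum fun i _ => by rw [add_comm T]; exact h i
  have h3 := hws.sum_le_tsum (Finset.range n) fun i _ => hw i
  rw [Finset.sum_range_add] at h1
  rw [← Finset.sum_div, Finset.sum_add_distrib] at h2
  linarith

lemma summable_sub_add {E : ℕ → ℝ} (hE : Antitone E) (hE0 : ∀ k, 0 ≤ E k) (T : ℕ) :
    Summable fun k => E k - E (k + T) := by
  have h1 : Summable fun k => E k - E (k + 1) := by
    refine summable_of_sum_range_le (c := E 0) (fun k => sub_nonneg.2 (hE k.le_succ)) fun n => ?_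
    have := sum_range_sub_succ_add E 0 n
    simp only [zero_add] at this
    rw [this]
    linarith [hE0 n]
  have h2 : Summable fun k => ∑ j ∈ Finset.range T, (E (k + j) - E (k + j + 1)) :=
    summable_sum fun j _ => (summable_nat_add_iff (f := fun k => E k - E (k + 1)) j).2 h1
  simpa only [sum_range_sub_succ_add] using! h2

/-- The square of a sum of `T` consecutive steps is controlled by the decrease of `E` over these
steps (Cauchy–Schwarz). -/
lemma sq_sum_range_le_of_decrease {E d : ℕ → ℝ} {c : ℝ}
    (hdec : ∀ k, E (k + 1) + c * d k ^ 2 ≤ E k) (hc : 0 < c) (T k : ℕ) :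
    c * (∑ j ∈ Finset.range T, d (k + j)) ^ 2 ≤ T * (E k - E (k + T)) := by
  have h1 := sq_sum_le_card_mul_sum_sq (s := Finset.range T) (f := fun j => d (k + j))
  have h2 : ∑ j ∈ Finset.range T, c * d (k + j) ^ 2
      ≤ ∑ j ∈ Finset.range T, (E (k + j) - E (k + j + 1)) :=
    Finset.sum_le_sum fun j _ => by linarith [hdec (k + j)]
  rw [sum_range_sub_succ_add, ← Finset.mul_sum] at h2
  rw [Finset.card_range] at h1
  calc _ ≤ c * (T * ∑ j ∈ Finset.range T, d (k + j) ^ 2) := by gcongr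
    _ = T * (c * ∑ j ∈ Finset.range T, d (k + j) ^ 2) := by ring
    _ ≤ _ := by gcongr

/-- If the energies `E` decrease by `c * d k ^ 2` and their power `σ` is eventually bounded by a
multiple of the last `T` steps, then the steps are summable. -/
lemma summable_of_decrease_of_rpow_le {E d : ℕ → ℝ} {c C σ : ℝ} {T : ℕ}
    (hE0 : ∀ k, 0 ≤ E k) (hd : ∀ k, 0 ≤ d k) (hc : 0 < c)
    (hdec : ∀ k, E (k + 1) + c * d k ^ 2 ≤ E k) (hσ0 : 0 ≤ σ) (hσ1 : σ < 1) (hC : 0 ≤ C)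
    (hT : 1 ≤ T) (h : ∀ᶠ k in atTop, E (k + T) ^ σ ≤ C * ∑ j ∈ Finset.range T, d (k + j)) :
    Summable d := by
  obtain ⟨K, hK⟩ := eventually_atTop.1 h
  have hanti : Antitone E := antitone_nat_of_succ_le fun k => by
    nlinarith [hdec k, mul_nonneg hc.le (sq_nonneg (d k))]
  set δ : ℕ → ℝ := fun k => ∑ j ∈ Finset.range T, d (k + j) with hδ
  have hδ0 : ∀ k, 0 ≤ δ k := fun k => Finset.sum_nonneg fun j _ => hd _
  set a := 1 - σ with ha
  have ha0 : 0 < a := by linarith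
  set e : ℕ → ℝ := fun k => E k ^ a with he
  have he_anti : Antitone e := fun i j hij => Real.rpow_le_rpow (hE0 _) (hanti hij) ha0.le
  set M := T * C / (c * a) with hM
  have hM0 : 0 ≤ M := by positivity
  set w : ℕ → ℝ := fun k => M * (e (k + T) - e (k + T + T)) with hw
  have hw0 : ∀ k, 0 ≤ w k := fun k => mul_nonneg hM0 (sub_nonneg.2 (he_anti (by omega)))
  have hws : Summable w := by
    refine Summable.mul_left M ?_
    exact (summable_nat_add_iff (f := fun k => e k - e (k + T)) T).2
      (summable_sub_add he_anti (fun k => Real.rpow_nonneg (hE0 k) _) T)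
  have key : ∀ k, K ≤ k → δ (k + T) ≤ (δ k + w k) / 2 := by
    intro k hk
    have h1 := sq_sum_range_le_of_decrease hdec hc T (k + T)
    have h2 := mul_sub_le_rpow_mul_rpow_sub ha0.le (by linarith) (hE0 (k + T))
      (hE0 (k + T + T))
    have h3 := hK k hk
    have h4 : 0 ≤ e (k + T) - e (k + T + T) := sub_nonneg.2 (he_anti (by omega))
    rw [show 1 - a = σ by rw [ha]; ring] at h2
    have h5 : c * a * δ (k + T) ^ 2 ≤ T * (C * δ k * (e (k + T) - e (k + T + T))) := by
      calc c * a * δ (k + T) ^ 2 = a * (c * δ (k + T) ^ 2) := by ring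
        _ ≤ a * (T * (E (k + T) - E (k + T + T))) := by gcongr
        _ = T * (a * (E (k + T) - E (k + T + T))) := by ring
        _ ≤ T * (E (k + T) ^ σ * (e (k + T) - e (k + T + T))) := by gcongr
        _ ≤ _ := by gcongr
    have h6 : δ (k + T) ^ 2 ≤ δ k * w k := by
      have : δ k * w k = T * (C * δ k * (e (k + T) - e (k + T + T))) / (c * a) := by
        simp only [hw, hM]; ring
      rw [this, le_div_iff₀ (by positivity)]
      linarith
    refine (pow_le_pow_iff_left₀ (hδ0 _) (by linarith [hδ0 k, hw0 k]) two_ne_zero).1 ?_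
    nlinarith [sq_nonneg (δ k - w k)]
  have hsum : Summable fun k => δ (k + K) := by
    refine summable_of_add_le_half (T := T) (w := fun k => w (k + K)) (fun k => hδ0 _)
      (fun k => hw0 _) ((summable_nat_add_iff K).2 hws) fun k => ?_
    have := key (k + K) (by omega)
    rwa [show k + K + T = k + T + K by omega] at this
  refine Summable.of_nonneg_of_le hd (fun k => ?_) ((summable_nat_add_iff K).1 hsum)
  simpa using Finset.single_le_sum (f := fun j => d (k + j)) (fun j _ => hd _)
    (Finset.mem_range.2 hT)

/-- A nonnegative antitone sequence that eventually contracts by a fixed factor every `T` terms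
decays geometrically. -/
lemma exists_geometric_bound_of_add_le {E : ℕ → ℝ} {q : ℝ} {T : ℕ} (hE0 : ∀ k, 0 ≤ E k)
    (hanti : Antitone E) (hT : 1 ≤ T) (hq0 : 0 < q) (hq1 : q < 1)
    (h : ∀ᶠ k in atTop, E (k + T) ≤ q * E k) :
    ∃ C ρ : ℝ, 0 ≤ C ∧ 0 < ρ ∧ ρ < 1 ∧ ∀ k, E k ≤ C * ρ ^ k := by
  obtain ⟨K, hK⟩ := eventually_atTop.1 h
  have hT0 : (0 : ℝ) < T := by exact_mod_cast hT
  set ρ := q ^ (1 / (T : ℝ)) with hρ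
  have hρ0 : 0 < ρ := Real.rpow_pos_of_pos hq0 _
  have hρ1 : ρ < 1 := Real.rpow_lt_one hq0.le hq1 (by positivity)
  have hρT : ρ ^ T = q := by
    rw [hρ, ← Real.rpow_natCast, ← Real.rpow_mul hq0.le]
    field_simp
    simp
  refine ⟨E 0 / ρ ^ (K + T), ρ, div_nonneg (hE0 0) (by positivity), hρ0, hρ1, fun k => ?_⟩
  induction k using Nat.strong_induction_on with
  | _ k ih =>
    rcases lt_or_ge k (K + T) with hk | hk
    · rw [div_mul_eq_mul_div, le_div_iff₀ (by positivity)]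
      exact mul_le_mul (hanti (Nat.zero_le _)) (pow_le_pow_of_le_one hρ0.le hρ1.le hk.le)
        (by positivity) (hE0 0)
    · obtain ⟨m, rfl⟩ : ∃ m, k = m + T := ⟨k - T, by omega⟩
      calc E (m + T) ≤ q * E m := hK m (by omega)
        _ ≤ q * (E 0 / ρ ^ (K + T) * ρ ^ m) := by gcongr; exact ih m (by omega)
        _ = E 0 / ρ ^ (K + T) * ρ ^ (m + T) := by rw [pow_add ρ m T, hρT]; ring

/-- With the exponent `1 / 2` the energies contract by a fixed factor every `T` iterations, so that
the steps decay geometrically. -/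
lemma exists_geometric_bound_of_decrease_of_sqrt_le {E d : ℕ → ℝ} {c C : ℝ} {T : ℕ}
    (hE0 : ∀ k, 0 ≤ E k) (hd : ∀ k, 0 ≤ d k) (hc : 0 < c)
    (hdec : ∀ k, E (k + 1) + c * d k ^ 2 ≤ E k) (hT : 1 ≤ T)
    (h : ∀ᶠ k in atTop, E (k + T) ^ (1 / 2 : ℝ) ≤ C * ∑ j ∈ Finset.range T, d (k + j)) :
    ∃ C ρ : ℝ, 0 ≤ C ∧ 0 < ρ ∧ ρ < 1 ∧ ∀ k, d k ≤ C * ρ ^ k := by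
  have hanti : Antitone E := antitone_nat_of_succ_le fun k => by
    nlinarith [hdec k, mul_nonneg hc.le (sq_nonneg (d k))]
  -- The summand `1` makes the contraction factor `A / (A + 1)` positive even if `C = 0`.
  set A := C ^ 2 * T / c + 1 with hA
  have hA0 : 1 ≤ A := le_add_of_nonneg_left (by positivity)
  have hq : ∀ᶠ k in atTop, E (k + T) ≤ A / (A + 1) * E k := by
    filter_upwards [h] with k hk
    have h1 := sq_sum_range_le_of_decrease hdec hc T k
    rw [← Real.sqrt_eq_rpow] at hk
    have h2 : E (k + T) ≤ C ^ 2 * (∑ j ∈ Finset.range T, d (k + j)) ^ 2 := by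
      rw [← Real.sq_sqrt (hE0 (k + T)), ← mul_pow]
      exact pow_le_pow_left₀ (Real.sqrt_nonneg _) hk 2
    have h3 : (∑ j ∈ Finset.range T, d (k + j)) ^ 2 ≤ T * (E k - E (k + T)) / c := by
      rw [le_div_iff₀ hc]; linarith
    have h4 : E (k + T) ≤ A * (E k - E (k + T)) := by
      calc E (k + T) ≤ C ^ 2 * (T * (E k - E (k + T)) / c) := h2.trans (by gcongr)
        _ = (A - 1) * (E k - E (k + T)) := by rw [hA]; ring
        _ ≤ _ := by
          have := hanti (Nat.le_add_right k T)
          nlinarith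
    rw [div_mul_eq_mul_div, le_div_iff₀ (by linarith)]
    linarith
  obtain ⟨B, ρ, hB, hρ0, hρ1, hE⟩ := exists_geometric_bound_of_add_le hE0 hanti hT
    (div_pos (by linarith) (by linarith)) ((div_lt_one (by linarith)).2 (by linarith)) hq
  refine ⟨√(B / c), √ρ, Real.sqrt_nonneg _, Real.sqrt_pos.2 hρ0,
    by rw [Real.sqrt_lt' one_pos]; simpa, fun k => ?_⟩
  refine (pow_le_pow_iff_left₀ (hd k) (by positivity) two_ne_zero).1 ?_
  rw [mul_pow, ← pow_mul, mul_comm k 2, pow_mul, Real.sq_sqrt hρ0.le,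
    Real.sq_sqrt (by positivity), div_mul_eq_mul_div, le_div_iff₀ hc]
  linarith [hE k, hdec k, hE0 (k + 1)]

/-! ### Smooth functions and the proximal mapping -/

section Smooth

variable {E : Type*} [NormedAddCommGroup E] [InnerProductSpace ℝ E] [CompleteSpace E]

/-- The quadratic bounds for a function with Lipschitz gradient. -/
lemma abs_sub_sub_inner_gradient_le {f : E → ℝ} {L : ℝ≥0} (hf : Differentiable ℝ f)
    (hL : LipschitzWith L (gradient f)) (x y : E) :
    |f y - f x - inner ℝ (gradient f x) (y - x)| ≤ L / 2 * ‖y - x‖ ^ 2 := by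
  set F : ℝ → ℝ := fun t => f (x + t • (y - x)) - f x - t * inner ℝ (gradient f x) (y - x) with hF
  set F' : ℝ → ℝ := fun t => inner ℝ (gradient f (x + t • (y - x)) - gradient f x) (y - x)
  have hder : ∀ t, HasDerivAt F (F' t) t := by
    intro t
    have h1 : HasDerivAt (fun t : ℝ => x + t • (y - x)) (y - x) t := by
      simpa using ((hasDerivAt_id t).smul_const (y - x)).const_add x
    have h2 := (hf (x + t • (y - x))).hasGradientAt.hasFDerivAt.comp_hasDerivAt t h1
    have h3 := (h2.sub_const (f x)).sub ((hasDerivAt_id t).mul_const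
      (inner ℝ (gradient f x) (y - x)))
    refine h3.congr_deriv ?_
    simp [F', inner_sub_left]
  have hB : ∀ t : ℝ, HasDerivAt (fun t : ℝ => L / 2 * ‖y - x‖ ^ 2 * t ^ 2)
      (L * ‖y - x‖ ^ 2 * t) t := fun t => by
    refine ((hasDerivAt_pow 2 t).const_mul _).congr_deriv ?_
    simp; ring
  have := image_norm_le_of_norm_deriv_right_le_deriv_boundary (f := F) (f' := F') (a := 0) (b := 1)
    (fun t _ => (hder t).continuousAt.continuousWithinAt)
    (fun t _ => (hder t).hasDerivWithinAt) (by simp [hF]) hB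
    (fun t ht => by
      refine (norm_inner_le_norm _ _).trans ?_
      have h := hL.dist_le_mul (x + t • (y - x)) x
      rw [dist_eq_norm, dist_eq_norm, add_sub_cancel_left, norm_smul, Real.norm_of_nonneg ht.1] at h
      calc _ ≤ L * (t * ‖y - x‖) * ‖y - x‖ := by gcongr
        _ = _ := by ring)
    (Set.right_mem_Icc.2 zero_le_one)
  simpa [hF] using this

end Smooth

lemma ne_top_of_mem_prox {E : Type*} [NormedAddCommGroup E] {g : E → EReal}
    (hg : ProperFun g) {t : ℝ} {v z : E} (hz : z ∈ prox t g v) : g z ≠ ⊤ := by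
  obtain ⟨y, hy⟩ := hg.2
  intro h
  have h1 := hz y
  lift g y to ℝ using ⟨hy, hg.1 y⟩ with a
  rw [h, EReal.top_add_coe, ← EReal.coe_add] at h1
  exact absurd h1 (not_le.2 (EReal.coe_lt_top _))

/-- Since the objective defining the proximal point is strongly convex, it grows quadratically
around the minimizer. -/
lemma add_sq_le_of_mem_prox {E : Type*} [NormedAddCommGroup E] [InnerProductSpace ℝ E]
    {g : E → EReal} (hg : ProperFun g) (hconv : ConvexFun g) {t : ℝ} {v z u : E}
    (hz : z ∈ prox t g v) (hu : g u ≠ ⊤) :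
    (g z).toReal + ‖z - v‖ ^ 2 / (2 * t) + ‖u - z‖ ^ 2 / (2 * t)
      ≤ (g u).toReal + ‖u - v‖ ^ 2 / (2 * t) := by
  have hzt := ne_top_of_mem_prox hg hz
  have hzr := EReal.coe_toReal hzt (hg.1 z)
  have hur := EReal.coe_toReal hu (hg.1 u)
  set a := (g z).toReal
  set b := (g u).toReal
  -- Compare `z` with the point `(1 - l) z + l u`, divide by `l`, and let `l` tend to `0`.
  have key : ∀ l : ℝ, 0 < l → l < 1 → a + ‖z - v‖ ^ 2 / (2 * t) + (1 - l) * (‖u - z‖ ^ 2 / (2 * t))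
      ≤ b + ‖u - v‖ ^ 2 / (2 * t) := by
    intro l h0 h1
    have hc := hconv z u (1 - l) l (by linarith) h0.le (by ring)
    have hm := (hz ((1 - l) • z + l • u)).trans (add_le_add_left hc _)
    rw [← hzr, ← hur] at hm
    norm_cast at hm
    have hid : ‖(1 - l) • z + l • u - v‖ ^ 2
        = (1 - l) * ‖z - v‖ ^ 2 + l * ‖u - v‖ ^ 2 - l * (1 - l) * ‖u - z‖ ^ 2 := by
      rw [show (1 - l) • z + l • u - v = (1 - l) • (z - v) + l • (u - v) by module,
        show u - z = (u - v) - (z - v) by abel, norm_add_sq_real, norm_sub_sq_real (u - v) (z - v),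
        norm_smul, norm_smul, mul_pow, mul_pow, inner_smul_left, inner_smul_right,
        real_inner_comm (u - v)]
      simp only [Real.norm_eq_abs, sq_abs, conj_trivial]
      ring
    rw [hid] at hm
    refine le_of_mul_le_mul_left ?_ h0
    have e : ∀ r : ℝ, r / (2 * t) = r * (2 * t)⁻¹ := fun r => div_eq_mul_inv _ _
    simp only [e] at hm ⊢
    nlinarith
  have hlim : Tendsto (fun l : ℝ => a + ‖z - v‖ ^ 2 / (2 * t)
      + (1 - l) * (‖u - z‖ ^ 2 / (2 * t))) (𝓝[>] 0)
      (𝓝 (a + ‖z - v‖ ^ 2 / (2 * t) + (1 - 0) * (‖u - z‖ ^ 2 / (2 * t)))) := by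
    refine (Continuous.tendsto ?_ _).mono_left nhdsWithin_le_nhds
    fun_prop
  rw [sub_zero, one_mul] at hlim
  refine le_of_tendsto hlim ?_
  filter_upwards [Ioo_mem_nhdsGT (zero_lt_one' ℝ)] with l hl using key l hl.1 hl.2

/-! ### The surrogate model of the smooth part -/

section Surrogate

variable {N n : ℕ} {f : Fin N → EuclideanSpace ℝ (Fin n) → ℝ} {γ : Fin N → ℝ} {L : Fin N → ℝ≥0}

/-- The separable quadratic model `w ↦ ∑ i, ((f i (x i) + ⟪∇f i (x i), w - x i⟫) / N +
‖w - x i‖² / (2 γ i))` of the smooth part of the cost, in which `f i` is linearized at a point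
`x i` of its own. -/
noncomputable def surrogate (f : Fin N → EuclideanSpace ℝ (Fin n) → ℝ) (γ : Fin N → ℝ)
    (x : Fin N → EuclideanSpace ℝ (Fin n)) (w : EuclideanSpace ℝ (Fin n)) : ℝ :=
  ∑ i, (1 / (N : ℝ) * (f i (x i) + inner ℝ (gradient (f i) (x i)) (w - x i))
    + ‖w - x i‖ ^ 2 / (2 * γ i))

/-- The average of the functions `f i`, the smooth part of the cost. -/
noncomputable def smoothPart (f : Fin N → EuclideanSpace ℝ (Fin n) → ℝ)
    (w : EuclideanSpace ℝ (Fin n)) : ℝ :=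
  (1 / (N : ℝ)) * ∑ i, f i w

lemma finiteSumCost_eq (g : EuclideanSpace ℝ (Fin n) → EReal) (w : EuclideanSpace ℝ (Fin n)) :
    finiteSumCost f g w = (smoothPart f w : EReal) + g w := rfl

lemma surrogate_self (w : EuclideanSpace ℝ (Fin n)) :
    surrogate f γ (fun _ => w) w = smoothPart f w := by
  simp [surrogate, smoothPart, Finset.mul_sum]

lemma gammaHat_pos (hN : 0 < N) (hγ0 : ∀ i, 0 < γ i) : 0 < gammaHat γ := by
  have : Nonempty (Fin N) := ⟨⟨0, hN⟩⟩
  exact inv_pos.2 (Finset.sum_pos (fun i _ => inv_pos.2 (hγ0 i)) Finset.univ_nonempty)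

/-- Up to a constant, the surrogate is the squared distance to the weighted average of the
forward steps; this is why the algorithm needs to store only that average. -/
lemma surrogate_sub_surrogate (hN : 0 < N) (hγ0 : ∀ i, 0 < γ i)
    (x : Fin N → EuclideanSpace ℝ (Fin n)) (u w : EuclideanSpace ℝ (Fin n)) :
    surrogate f γ x u - surrogate f γ x w =
      ‖u - gammaHat γ • ∑ i, (γ i)⁻¹ • forwardStep f γ i (x i)‖ ^ 2 / (2 * gammaHat γ)
      - ‖w - gammaHat γ • ∑ i, (γ i)⁻¹ • forwardStep f γ i (x i)‖ ^ 2 / (2 * gammaHat γ) := by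
  have hG := gammaHat_pos hN hγ0
  have hN0 : (N : ℝ) ≠ 0 := by exact_mod_cast hN.ne'
  set S := ∑ i, (γ i)⁻¹ • forwardStep f γ i (x i) with hS
  have hR : ‖u - gammaHat γ • S‖ ^ 2 / (2 * gammaHat γ)
      - ‖w - gammaHat γ • S‖ ^ 2 / (2 * gammaHat γ)
      = (gammaHat γ)⁻¹ * ((‖u‖ ^ 2 - ‖w‖ ^ 2) / 2) - inner ℝ (u - w) S := by
    rw [norm_sub_sq_real, norm_sub_sq_real, inner_smul_right, inner_smul_right, inner_sub_left]
    field_simp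
    ring
  rw [hR, gammaHat, inv_inv, hS, inner_sum, Finset.sum_mul, surrogate, surrogate,
    ← Finset.sum_sub_distrib, ← Finset.sum_sub_distrib]
  refine Finset.sum_congr rfl fun i _ => ?_
  have hi := (hγ0 i).ne'
  rw [forwardStep, norm_sub_sq_real, norm_sub_sq_real, inner_smul_right]
  simp only [inner_sub_right, inner_sub_left, inner_smul_right,
    real_inner_comm _ (gradient (f i) (x i))]
  field_simp
  ring

variable (hf : ∀ i, Differentiable ℝ (f i)) (hL : ∀ i, LipschitzWith (L i) (gradient (f i)))
  (hγ0 : ∀ i, 0 < γ i)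

include hf hL hγ0

/-- Moving linearization points to the current point does not increase the surrogate, because each
model majorizes `f i / N` under the stepsize restriction. -/
lemma surrogate_update_le (hN : 0 < N) (hγ : ∀ i, γ i * (L i : ℝ) < (N : ℝ)) (I : Finset (Fin N))
    (x : Fin N → EuclideanSpace ℝ (Fin n)) (w : EuclideanSpace ℝ (Fin n)) :
    surrogate f γ (fun i => if i ∈ I then w else x i) w ≤ surrogate f γ x w := by
  refine Finset.sum_le_sum fun i _ => ?_
  beta_reduce
  split_ifs with h
  · have h1 := (abs_le.1 (abs_sub_sub_inner_gradient_le (hf i) (hL i) (x i) w)).2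
    have hN0 : (0 : ℝ) < N := by exact_mod_cast hN
    have h2 : 1 / (N : ℝ) * (L i / 2 * ‖w - x i‖ ^ 2) ≤ ‖w - x i‖ ^ 2 / (2 * γ i) := by
      have h3 : (L i : ℝ) / N ≤ 1 / γ i := by
        rw [div_le_div_iff₀ hN0 (hγ0 i)]; linarith [hγ i]
      calc 1 / (N : ℝ) * (L i / 2 * ‖w - x i‖ ^ 2) = L i / N * (‖w - x i‖ ^ 2 / 2) := by ring
        _ ≤ 1 / γ i * (‖w - x i‖ ^ 2 / 2) := by gcongr
        _ = _ := by ring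
    have h4 : 1 / (N : ℝ) * (f i w - f i (x i) - inner ℝ (gradient (f i) (x i)) (w - x i))
        ≤ 1 / (N : ℝ) * (L i / 2 * ‖w - x i‖ ^ 2) := by gcongr
    simp only [sub_self, inner_zero_right, norm_zero, add_zero]
    have h5 := h4.trans h2
    rw [mul_sub, mul_sub] at h5
    simp only [ne_eq, OfNat.ofNat_ne_zero, not_false_eq_true, zero_pow, zero_div, add_zero, mul_add]
    linarith
  · exact le_rfl

lemma smoothPart_le_surrogate (hN : 0 < N) (hγ : ∀ i, γ i * (L i : ℝ) < (N : ℝ))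
    (x : Fin N → EuclideanSpace ℝ (Fin n)) (w : EuclideanSpace ℝ (Fin n)) :
    smoothPart f w ≤ surrogate f γ x w := by
  simpa [surrogate_self] using surrogate_update_le hf hL hγ0 hN hγ Finset.univ x w

lemma surrogate_le_smoothPart_add {x : Fin N → EuclideanSpace ℝ (Fin n)}
    {w : EuclideanSpace ℝ (Fin n)} {δ : ℝ} (hδ : ∀ i, ‖w - x i‖ ≤ δ) :
    surrogate f γ x w
      ≤ smoothPart f w + (∑ i, (1 / (N : ℝ) * (L i / 2) + 1 / (2 * γ i))) * δ ^ 2 := by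
  rw [surrogate, smoothPart, Finset.mul_sum, Finset.sum_mul, ← Finset.sum_add_distrib]
  refine Finset.sum_le_sum fun i _ => ?_
  have h1 := (abs_le.1 (abs_sub_sub_inner_gradient_le (hf i) (hL i) (x i) w)).1
  have h2 : ‖w - x i‖ ^ 2 ≤ δ ^ 2 := pow_le_pow_left₀ (norm_nonneg _) (hδ i) 2
  have h3 : 1 / (N : ℝ) * (f i (x i) + inner ℝ (gradient (f i) (x i)) (w - x i))
      ≤ 1 / (N : ℝ) * (f i w + L i / 2 * δ ^ 2) := by
    have : (L i : ℝ) / 2 * ‖w - x i‖ ^ 2 ≤ L i / 2 * δ ^ 2 := by gcongr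
    refine mul_le_mul_of_nonneg_left ?_ (by positivity)
    linarith
  have h4 : ‖w - x i‖ ^ 2 / (2 * γ i) ≤ δ ^ 2 / (2 * γ i) := by
    have := hγ0 i
    gcongr
  calc _ ≤ 1 / (N : ℝ) * (f i w + L i / 2 * δ ^ 2) + δ ^ 2 / (2 * γ i) := add_le_add h3 h4
    _ = _ := by ring

omit hf hL hγ0 in
/-- The gradient at `w` of the difference between the smooth part and the surrogate. -/
noncomputable def surrogateResidual (f : Fin N → EuclideanSpace ℝ (Fin n) → ℝ) (γ : Fin N → ℝ)
    (x : Fin N → EuclideanSpace ℝ (Fin n)) (w : EuclideanSpace ℝ (Fin n)) :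
    EuclideanSpace ℝ (Fin n) :=
  ∑ i, ((1 / (N : ℝ)) • (gradient (f i) w - gradient (f i) (x i)) - (γ i)⁻¹ • (w - x i))

omit hf in
lemma norm_surrogateResidual_le {x : Fin N → EuclideanSpace ℝ (Fin n)}
    {w : EuclideanSpace ℝ (Fin n)} {δ : ℝ} (hδ : ∀ i, ‖w - x i‖ ≤ δ) :
    ‖surrogateResidual f γ x w‖ ≤ (∑ i, (1 / (N : ℝ) * L i + (γ i)⁻¹)) * δ := by
  rw [surrogateResidual, Finset.sum_mul]
  refine norm_sum_le_of_le _ fun i _ => (norm_sub_le _ _).trans ?_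
  have h1 := (hL i).dist_le_mul w (x i)
  rw [dist_eq_norm, dist_eq_norm] at h1
  have h0 := hγ0 i
  rw [norm_smul, norm_smul, Real.norm_of_nonneg (by positivity),
    Real.norm_of_nonneg (by positivity), add_mul, mul_assoc]
  have h2 : ‖gradient (f i) w - gradient (f i) (x i)‖ ≤ L i * δ := h1.trans (by gcongr; exact hδ i)
  gcongr
  exact hδ i

lemma inner_surrogateResidual_sub_le (x : Fin N → EuclideanSpace ℝ (Fin n))
    (u w : EuclideanSpace ℝ (Fin n)) :
    inner ℝ (surrogateResidual f γ x w) (u - w)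
        - (∑ i, (1 / (N : ℝ) * (L i / 2) + 1 / (2 * γ i))) * ‖u - w‖ ^ 2
      ≤ (smoothPart f u - smoothPart f w) - (surrogate f γ x u - surrogate f γ x w) := by
  rw [surrogate, surrogate, smoothPart, smoothPart, surrogateResidual, Finset.mul_sum,
    Finset.mul_sum, Finset.sum_mul, sum_inner, ← Finset.sum_sub_distrib, ← Finset.sum_sub_distrib,
    ← Finset.sum_sub_distrib, ← Finset.sum_sub_distrib]
  refine Finset.sum_le_sum fun i _ => ?_
  have h1 := (abs_le.1 (abs_sub_sub_inner_gradient_le (hf i) (hL i) w u)).1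
  have h2 : 1 / (N : ℝ) * (inner ℝ (gradient (f i) w) (u - w) - L i / 2 * ‖u - w‖ ^ 2)
      ≤ 1 / (N : ℝ) * (f i u - f i w) := by
    refine mul_le_mul_of_nonneg_left ?_ (by positivity)
    linarith
  have h3 : ‖u - x i‖ ^ 2 = ‖u - w‖ ^ 2 + 2 * inner ℝ (w - x i) (u - w) + ‖w - x i‖ ^ 2 := by
    rw [show u - x i = (u - w) + (w - x i) by abel, norm_add_sq_real, real_inner_comm]
  have h4 : inner ℝ (gradient (f i) (x i)) (u - x i)
      = inner ℝ (gradient (f i) (x i)) (u - w) + inner ℝ (gradient (f i) (x i)) (w - x i) := by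
    rw [← inner_add_right]; congr 1; abel
  rw [h3, h4, inner_sub_left, inner_smul_left, inner_smul_left, inner_sub_left, conj_trivial,
    conj_trivial]
  have h5 : (‖u - w‖ ^ 2 + 2 * inner ℝ (w - x i) (u - w) + ‖w - x i‖ ^ 2) / (2 * γ i)
      = 1 / (2 * γ i) * ‖u - w‖ ^ 2 + (γ i)⁻¹ * inner ℝ (w - x i) (u - w)
        + ‖w - x i‖ ^ 2 / (2 * γ i) := by
    have := (hγ0 i).ne'
    field_simp
  rw [h5]
  linarith

/-- At a minimizer of `g` plus the surrogate, the residual is a regular subgradient of the cost. -/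
lemma surrogateResidual_mem_regularSubdiff {g : EuclideanSpace ℝ (Fin n) → EReal}
    (hg : ∀ u, g u ≠ ⊥) {x : Fin N → EuclideanSpace ℝ (Fin n)} {w : EuclideanSpace ℝ (Fin n)}
    (hw : g w ≠ ⊤)
    (hmin : ∀ u, g u ≠ ⊤ → (g w).toReal + surrogate f γ x w ≤ (g u).toReal + surrogate f γ x u) :
    surrogateResidual f γ x w ∈ regularSubdiff (finiteSumCost f g) w := by
  have hwr := EReal.coe_toReal hw (hg w)
  have hφ : finiteSumCost f g w = ((smoothPart f w + (g w).toReal : ℝ) : EReal) := by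
    rw [finiteSumCost_eq, EReal.coe_add, hwr]
  refine ⟨by rw [hφ]; exact EReal.coe_ne_top _, by rw [hφ]; exact EReal.coe_ne_bot _,
    fun ε hε => ?_⟩
  set K := ∑ i, (1 / (N : ℝ) * (L i / 2) + 1 / (2 * γ i)) with hK
  have hK0 : 0 ≤ K := Finset.sum_nonneg fun i _ => by have := hγ0 i; positivity
  filter_upwards [Metric.ball_mem_nhds w (show 0 < ε / (K + 1) by positivity)] with u hu
  by_cases hut : g u = ⊤
  · rw [finiteSumCost_eq g u, hut, EReal.coe_add_top]
    exact le_top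
  have hur := EReal.coe_toReal hut (hg u)
  rw [hφ, finiteSumCost_eq g u, ← hur, ← EReal.coe_add, ← EReal.coe_add, EReal.coe_le_coe_iff]
  have h1 := inner_surrogateResidual_sub_le hf hL hγ0 x u w
  rw [← hK] at h1
  have h2 := hmin u hut
  rw [mem_ball_iff_norm, lt_div_iff₀ (by positivity)] at hu
  nlinarith [norm_nonneg (u - w)]

end Surrogate

lemma regularSubdiff_subset_subdiff {E : Type*} [NormedAddCommGroup E] [InnerProductSpace ℝ E]
    (h : E → EReal) (x : E) : regularSubdiff h x ⊆ subdiff h x := fun v hv =>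
  ⟨hv.1, hv.2.1, fun _ => x, fun _ => v, tendsto_const_nhds, tendsto_const_nhds, fun _ => hv,
    tendsto_const_nhds⟩

/-! ### The iterates of the algorithm -/

/-- The points at which the gradients were last evaluated before iteration `k`. -/
noncomputable def lastEval {N n : ℕ} (I : ℕ → Finset (Fin N)) (xinit : EuclideanSpace ℝ (Fin n))
    (z : ℕ → EuclideanSpace ℝ (Fin n)) : ℕ → Fin N → EuclideanSpace ℝ (Fin n)
  | 0, _ => xinit
  | k + 1, i => if i ∈ I k then z k else lastEval I xinit z k i

/-- The Lyapunov function `min_w {g w + surrogate (lastEval k) w}`, whose minimum is attained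
at `z k`. -/
noncomputable def lyapunov {N n : ℕ} (f : Fin N → EuclideanSpace ℝ (Fin n) → ℝ)
    (g : EuclideanSpace ℝ (Fin n) → EReal) (γ : Fin N → ℝ) (I : ℕ → Finset (Fin N))
    (xinit : EuclideanSpace ℝ (Fin n)) (z : ℕ → EuclideanSpace ℝ (Fin n)) (k : ℕ) : ℝ :=
  (g (z k)).toReal + surrogate f γ (lastEval I xinit z k) (z k)

/-- Under essentially cyclic sampling each gradient was evaluated at one of the last `T`
iterates. -/
lemma norm_sub_lastEval_le {N n : ℕ} {I : ℕ → Finset (Fin N)} {T : ℕ}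
    (hI : ∀ (i : Fin N) (k : ℕ), ∃ j, k ≤ j ∧ j < k + T ∧ i ∈ I j)
    (xinit : EuclideanSpace ℝ (Fin n)) (z : ℕ → EuclideanSpace ℝ (Fin n)) (k : ℕ) (i : Fin N) :
    ‖z (k + T) - lastEval I xinit z (k + T) i‖
      ≤ ∑ j ∈ Finset.range T, ‖z (k + j + 1) - z (k + j)‖ := by
  -- Once `i` has been selected at iteration `j`, the gradient is evaluated at iterates from
  -- `j` on.
  have key : ∀ j l, i ∈ I j → j < l → ∃ m, j ≤ m ∧ m < l ∧ lastEval I xinit z l i = z m := by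
    intro j l hj hl
    induction l, hl using Nat.le_induction with
    | base => exact ⟨j, le_rfl, Nat.lt_succ_self j, if_pos hj⟩
    | succ l hl ih =>
      by_cases h : i ∈ I l
      · exact ⟨l, by omega, by omega, if_pos h⟩
      · obtain ⟨m, h1, h2, h3⟩ := ih
        exact ⟨m, h1, by omega, (if_neg h).trans h3⟩
  obtain ⟨j, hkj, hjT, hij⟩ := hI i k
  obtain ⟨m, hjm, hmT, hm⟩ := key j (k + T) hij hjT
  rw [hm, ← dist_eq_norm, dist_comm]
  refine (dist_le_Ico_sum_dist z hmT.le).trans ?_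
  refine (Finset.sum_le_sum_of_subset_of_nonneg (t := Finset.Ico k (k + T))
    (Finset.Ico_subset_Ico (by omega) le_rfl) fun _ _ _ => dist_nonneg).trans ?_
  rw [Finset.sum_Ico_eq_sum_range, Nat.add_sub_cancel_left]
  exact (Finset.sum_congr rfl fun j _ => by rw [dist_comm, dist_eq_norm]).le

namespace IsFinitoRun

variable {N n : ℕ} {f : Fin N → EuclideanSpace ℝ (Fin n) → ℝ}
  {g : EuclideanSpace ℝ (Fin n) → EReal} {γ : Fin N → ℝ} {xinit : EuclideanSpace ℝ (Fin n)}
  {I : ℕ → Finset (Fin N)} {s : ℕ → Fin N → EuclideanSpace ℝ (Fin n)}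
  {shat z : ℕ → EuclideanSpace ℝ (Fin n)}

lemma s_eq (hrun : IsFinitoRun f g γ xinit I s shat z) (k : ℕ) (i : Fin N) :
    s k i = forwardStep f γ i (lastEval I xinit z k i) := by
  induction k with
  | zero => exact hrun.s_zero i
  | succ k ih =>
    rw [hrun.s_succ, ih, lastEval]
    split_ifs <;> rfl

lemma shat_eq (hrun : IsFinitoRun f g γ xinit I s shat z) (k : ℕ) :
    shat k = gammaHat γ • ∑ i, (γ i)⁻¹ • s k i := by
  induction k with
  | zero => exact hrun.shat_zero
  | succ k ih =>
    have h : ∀ i, (γ i)⁻¹ • s (k + 1) i = (γ i)⁻¹ • s k i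
        + if i ∈ I k then (γ i)⁻¹ • (forwardStep f γ i (z k) - s k i) else 0 := by
      intro i
      rw [hrun.s_succ]
      split_ifs
      · rw [← smul_add, add_sub_cancel]
      · rw [add_zero]
    simp_rw [h]
    rw [Finset.sum_add_distrib, Finset.sum_ite_mem, Finset.univ_inter, smul_add, ← ih,
      hrun.shat_succ, Finset.smul_sum]
    simp_rw [smul_smul, div_eq_mul_inv]

/-- The iterate `z k` minimizes `g` plus the surrogate, with quadratic growth. -/
lemma lyapunov_add_sq_le (hrun : IsFinitoRun f g γ xinit I s shat z) (hN : 0 < N)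
    (hγ0 : ∀ i, 0 < γ i) (hg : ProperFun g) (hconv : ConvexFun g) (k : ℕ)
    {u : EuclideanSpace ℝ (Fin n)} (hu : g u ≠ ⊤) :
    lyapunov f g γ I xinit z k + 1 / (2 * gammaHat γ) * ‖u - z k‖ ^ 2
      ≤ (g u).toReal + surrogate f γ (lastEval I xinit z k) u := by
  have h1 := add_sq_le_of_mem_prox hg hconv (hrun.z_mem k) hu
  have h2 := surrogate_sub_surrogate (f := f) hN hγ0 (lastEval I xinit z k) u (z k)
  simp_rw [← hrun.s_eq, ← hrun.shat_eq] at h2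
  rw [lyapunov, one_div_mul_eq_div]
  linarith

lemma lyapunov_le (hrun : IsFinitoRun f g γ xinit I s shat z) (hN : 0 < N)
    (hγ0 : ∀ i, 0 < γ i) (hg : ProperFun g) (hconv : ConvexFun g) (k : ℕ)
    {u : EuclideanSpace ℝ (Fin n)} (hu : g u ≠ ⊤) :
    lyapunov f g γ I xinit z k ≤ (g u).toReal + surrogate f γ (lastEval I xinit z k) u := by
  have h1 := hrun.lyapunov_add_sq_le hN hγ0 hg hconv k hu
  have h2 := gammaHat_pos hN hγ0
  have h3 : 0 ≤ 1 / (2 * gammaHat γ) * ‖u - z k‖ ^ 2 := by positivity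
  linarith

/-- Sufficient decrease of the Lyapunov function. -/
lemma lyapunov_succ_add_sq_le (hrun : IsFinitoRun f g γ xinit I s shat z) (hN : 0 < N)
    {L : Fin N → ℝ≥0} (hf : ∀ i, Differentiable ℝ (f i))
    (hL : ∀ i, LipschitzWith (L i) (gradient (f i)))
    (hγ0 : ∀ i, 0 < γ i) (hγ : ∀ i, γ i * (L i : ℝ) < (N : ℝ))
    (hg : ProperFun g) (hconv : ConvexFun g) (k : ℕ) :
    lyapunov f g γ I xinit z (k + 1) + 1 / (2 * gammaHat γ) * ‖z (k + 1) - z k‖ ^ 2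
      ≤ lyapunov f g γ I xinit z k := by
  have h1 := hrun.lyapunov_add_sq_le hN hγ0 hg hconv (k + 1)
    (ne_top_of_mem_prox hg (hrun.z_mem k))
  have h2 := surrogate_update_le hf hL hγ0 hN hγ (I k) (lastEval I xinit z k) (z k)
  rw [norm_sub_rev] at h1
  exact h1.trans (add_le_add le_rfl h2)

end IsFinitoRun

/-! ### Limit points and the Łojasiewicz inequality -/

lemma tendsto_surrogate {N n : ℕ} {f : Fin N → EuclideanSpace ℝ (Fin n) → ℝ} {γ : Fin N → ℝ}
    (hf : ∀ i, Continuous (f i)) (hf' : ∀ i, Continuous (gradient (f i)))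
    {x : ℕ → Fin N → EuclideanSpace ℝ (Fin n)} {y : ℕ → EuclideanSpace ℝ (Fin n)}
    {w u : EuclideanSpace ℝ (Fin n)} (hx : ∀ i, Tendsto (fun k => x k i) atTop (𝓝 w))
    (hy : Tendsto y atTop (𝓝 u)) :
    Tendsto (fun k => surrogate f γ (x k) (y k)) atTop (𝓝 (surrogate f γ (fun _ => w) u)) := by
  refine tendsto_finsetSum _ fun i _ => ?_
  have h1 : Tendsto (fun k => f i (x k i)) atTop (𝓝 (f i w)) := ((hf i).tendsto w).comp (hx i)
  have h2 : Tendsto (fun k => gradient (f i) (x k i)) atTop (𝓝 (gradient (f i) w)) :=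
    ((hf' i).tendsto w).comp (hx i)
  have h3 : Tendsto (fun k => y k - x k i) atTop (𝓝 (u - w)) := hy.sub (hx i)
  exact ((h1.add (h2.inner h3)).const_mul _).add ((h3.norm.pow 2).div_const _)

/-- A limit of minimizers of `g` plus surrogates whose linearization points all tend to the same
limit is a stationary point, and the cost there is the limit of the minimal values. -/
lemma isStationaryPoint_of_tendsto {N n : ℕ} {f : Fin N → EuclideanSpace ℝ (Fin n) → ℝ}
    {g : EuclideanSpace ℝ (Fin n) → EReal} {γ : Fin N → ℝ} {L : Fin N → ℝ≥0}
    (hf : ∀ i, Differentiable ℝ (f i)) (hL : ∀ i, LipschitzWith (L i) (gradient (f i)))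
    (hγ0 : ∀ i, 0 < γ i) (hg : ∀ u, g u ≠ ⊥) (hlsc : LowerSemicontinuous g)
    {x : ℕ → Fin N → EuclideanSpace ℝ (Fin n)} {z : ℕ → EuclideanSpace ℝ (Fin n)}
    {w : EuclideanSpace ℝ (Fin n)} {v : ℝ} (hz : Tendsto z atTop (𝓝 w))
    (hx : ∀ i, Tendsto (fun k => x k i) atTop (𝓝 w)) (hzt : ∀ k, g (z k) ≠ ⊤)
    (hv : Tendsto (fun k => (g (z k)).toReal + surrogate f γ (x k) (z k)) atTop (𝓝 v))
    (hmin : ∀ k u, g u ≠ ⊤ → (g (z k)).toReal + surrogate f γ (x k) (z k)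
      ≤ (g u).toReal + surrogate f γ (x k) u) :
    finiteSumCost f g w = (v : EReal) ∧ IsStationaryPoint (finiteSumCost f g) w := by
  have hs := fun (y : ℕ → EuclideanSpace ℝ (Fin n)) (u : EuclideanSpace ℝ (Fin n)) =>
    tendsto_surrogate (γ := γ) (y := y) (u := u) (fun i => (hf i).continuous)
      (fun i => (hL i).continuous) hx
  have hsz : Tendsto (fun k => surrogate f γ (x k) (z k)) atTop (𝓝 (smoothPart f w)) := by
    rw [← surrogate_self (γ := γ) w]
    exact hs z w hz
  have hgz : Tendsto (fun k => (g (z k)).toReal) atTop (𝓝 (v - smoothPart f w)) := by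
    simpa using hv.sub hsz
  have hle : g w ≤ ((v - smoothPart f w : ℝ) : EReal) := by
    by_contra! h
    obtain ⟨a, ha1, ha2⟩ := EReal.lt_iff_exists_real_btwn.1 h
    have h1 : ∀ᶠ k in atTop, a ≤ (g (z k)).toReal := by
      filter_upwards [hz.eventually (hlsc w a ha2)] with k hk
      rw [← EReal.coe_toReal (hzt k) (hg _)] at hk
      exact (EReal.coe_lt_coe_iff.1 hk).le
    exact absurd (ge_of_tendsto hgz h1) (not_le.2 (EReal.coe_lt_coe_iff.1 ha1))
  have hwt : g w ≠ ⊤ := (hle.trans_lt (EReal.coe_lt_top _)).ne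
  have hwr := EReal.coe_toReal hwt (hg w)
  rw [← hwr, EReal.coe_le_coe_iff] at hle
  have hlim : ∀ u, g u ≠ ⊤ → v ≤ (g u).toReal + surrogate f γ (fun _ => w) u := fun u hu =>
    le_of_tendsto_of_tendsto' hv ((hs _ u tendsto_const_nhds).const_add _) fun k => hmin k u hu
  have hval : v = (g w).toReal + surrogate f γ (fun _ => w) w := by
    refine le_antisymm (hlim w hwt) ?_
    rw [surrogate_self]
    linarith
  refine ⟨?_, ?_⟩
  · rw [finiteSumCost_eq, ← hwr, ← EReal.coe_add, hval, surrogate_self, add_comm]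
  · have := surrogateResidual_mem_regularSubdiff hf hL hγ0 hg hwt (x := fun _ => w)
      fun u hu => hval ▸ hlim u hu
    simpa [IsStationaryPoint, surrogateResidual] using this

/-- The KL property in the form of an error bound. -/
lemma HasKLAt.exists_rpow_le {E : Type*} [NormedAddCommGroup E] [InnerProductSpace ℝ E]
    {h : E → EReal} {θ : ℝ} {w : E} (hKL : HasKLAt h θ w) (hθ1 : θ < 1) {v : ℝ}
    (hv : h w = (v : EReal)) :
    ∃ ε η C : ℝ, 0 < ε ∧ 0 < η ∧ 0 ≤ C ∧ ∀ (y : E) (r : ℝ) (u : E), h y = (r : EReal) →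
      u ∈ subdiff h y → ‖y - w‖ < ε → v < r → r < v + η → (r - v) ^ θ ≤ C * ‖u‖ := by
  obtain ⟨ε, η, ϱ, hε, hη, hϱ, hk⟩ := hKL
  refine ⟨ε, η, ϱ * (1 - θ), hε, hη, mul_nonneg hϱ.le (by linarith),
    fun y r u hr hu hy hvr hrη => ?_⟩
  have h1 := hk y hy (by rw [hv, hr]; exact_mod_cast hvr) (by rw [hv, hr]; exact_mod_cast hrη)
  rw [hv, hr, EReal.toReal_coe, EReal.toReal_coe] at h1
  have hpos : 0 < r - v := by linarith
  have hder : deriv (desing ϱ θ) (r - v) = ϱ * (1 - θ) * ((r - v) ^ θ)⁻¹ := by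
    have := ((Real.hasDerivAt_rpow_const (p := 1 - θ) (Or.inl hpos.ne')).const_mul ϱ).deriv
    rw [show (1 - θ - 1) = -θ by ring, Real.rpow_neg hpos.le] at this
    rw [mul_assoc]
    exact this
  have hed : Metric.infEDist 0 (subdiff h y) ≤ ENNReal.ofReal ‖u‖ := by
    refine (Metric.infEDist_le_edist_of_mem hu).trans_eq ?_
    rw [edist_dist, dist_zero_left]
  have h2 := h1.trans (mul_le_mul_right hed _)
  have hnn : 0 ≤ ϱ * (1 - θ) * ((r - v) ^ θ)⁻¹ :=
    mul_nonneg (mul_nonneg hϱ.le (by linarith)) (by positivity)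
  rw [hder, ← ENNReal.ofReal_mul hnn, ENNReal.one_le_ofReal, mul_right_comm,
    ← div_eq_mul_inv, one_le_div (Real.rpow_pos_of_pos hpos _)] at h2
  exact h2

/-- Passing from an error bound for the cost to one for a quantity exceeding it by at most a
quadratic term in the residual turns the exponent `θ` into `max θ (1 / 2)`. -/
lemma rpow_max_half_le {e a A B θ δ : ℝ} (he0 : 0 ≤ e) (he : e ≤ max a 0 + A * δ ^ 2)
    (hA : 0 ≤ A) (hB : 0 ≤ B) (hδ0 : 0 ≤ δ) (hδ1 : δ ≤ 1) (ha1 : a ≤ 1) (hθ0 : 0 < θ)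
    (hθ1 : θ < 1) (ha : 0 < a → a ^ θ ≤ B * δ) :
    e ^ (max θ (1 / 2)) ≤ (B + A ^ (max θ (1 / 2))) * δ := by
  set σ := max θ (1 / 2) with hσ
  have hσ0 : 0 < σ := lt_max_of_lt_left hθ0
  have hσ1 : σ ≤ 1 := max_le hθ1.le (by norm_num)
  have h1 : (max a 0) ^ σ ≤ B * δ := by
    rcases le_or_gt a 0 with h | h
    · rw [max_eq_right h, Real.zero_rpow hσ0.ne']
      positivity
    · rw [max_eq_left h.le]
      exact (Real.rpow_le_rpow_of_exponent_ge h ha1 (le_max_left _ _)).trans (ha h)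
  have h2 : (δ ^ 2) ^ σ ≤ δ := by
    rcases hδ0.eq_or_lt with rfl | h
    · simp [Real.zero_rpow hσ0.ne']
    · calc (δ ^ 2) ^ σ ≤ (δ ^ 2) ^ (1 / 2 : ℝ) :=
          Real.rpow_le_rpow_of_exponent_ge (by positivity) (pow_le_one₀ hδ0 hδ1) (le_max_right _ _)
        _ = δ := by rw [← Real.sqrt_eq_rpow, Real.sqrt_sq hδ0]
  calc e ^ σ ≤ (max a 0 + A * δ ^ 2) ^ σ := Real.rpow_le_rpow he0 he hσ0.le
    _ ≤ (max a 0) ^ σ + (A * δ ^ 2) ^ σ :=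
      Real.rpow_add_le_add_rpow (le_max_right _ _) (by positivity) hσ0.le hσ1
    _ ≤ B * δ + A ^ σ * δ := by
      rw [Real.mul_rpow hA (by positivity)]
      gcongr
    _ = _ := by ring

/-! ### Convergence of the algorithm -/

lemma CoerciveFun.exists_norm_lt {E : Type*} [NormedAddCommGroup E] {h : E → EReal}
    (hh : CoerciveFun h) (a : ℝ) : ∃ R : ℝ, ∀ x, h x ≤ a → ‖x‖ < R := by
  have h1 : ∀ᶠ x in comap (fun x : E => ‖x‖) atTop, (a : EReal) < h x :=
    hh.eventually (lt_mem_nhds (EReal.coe_lt_top a))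
  rw [eventually_comap] at h1
  obtain ⟨R, hR⟩ := eventually_atTop.1 h1
  refine ⟨R, fun x hx => ?_⟩
  by_contra! h2
  exact absurd hx (not_le.2 (hR _ h2 x rfl))

lemma continuous_smoothPart {N n : ℕ} {f : Fin N → EuclideanSpace ℝ (Fin n) → ℝ}
    (hf : ∀ i, Differentiable ℝ (f i)) : Continuous (smoothPart f) :=
  continuous_const.mul (continuous_finsetSum _ fun i _ => (hf i).continuous)

/-- The sum of a continuous real function and a proper lower semicontinuous function is bounded
below on a compact set. -/
lemma exists_forall_le_add_toReal {X : Type*} [TopologicalSpace X] {F : X → ℝ} {g : X → EReal}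
    {K : Set X} (hK : IsCompact K) (hF : Continuous F) (hg : ∀ x, g x ≠ ⊥)
    (hlsc : LowerSemicontinuous g) :
    ∃ b : ℝ, ∀ x ∈ K, g x ≠ ⊤ → b ≤ F x + (g x).toReal := by
  rcases K.eq_empty_or_nonempty with rfl | hne
  · exact ⟨0, fun x hx => hx.elim⟩
  obtain ⟨p, -, hp⟩ := hK.exists_isMinOn hne hF.continuousOn
  obtain ⟨q, -, hq⟩ :=
    LowerSemicontinuousOn.exists_isMinOn hne hK (hlsc.lowerSemicontinuousOn K)
  refine ⟨F p + (g q).toReal, fun x hx hxt => add_le_add (hp hx) ?_⟩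
  exact EReal.toReal_le_toReal (hq hx) (hg q) hxt

theorem mainTheorem7 {N n : ℕ} (hN : 0 < N)
    (f : Fin N → EuclideanSpace ℝ (Fin n) → ℝ) (g : EuclideanSpace ℝ (Fin n) → EReal)
    (L : Fin N → ℝ≥0)
    (hf : ∀ i, Differentiable ℝ (f i))
    (hL : ∀ i, LipschitzWith (L i) (gradient (f i)))
    (hg_proper : ProperFun g) (hg_convex : ConvexFun g) (hg_lsc : LowerSemicontinuous g)
    (hcoercive : CoerciveFun (finiteSumCost f g))
    (θ : ℝ) (hθ0 : 0 < θ) (hθ1 : θ < 1) (hKL : HasKL (finiteSumCost f g) θ)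
    -- stepsizes `γ i ∈ (0, N / L i)`, where `N / 0 = ∞`
    (γ : Fin N → ℝ) (hγ0 : ∀ i, 0 < γ i) (hγ : ∀ i, γ i * (L i : ℝ) < (N : ℝ))
    (xinit : EuclideanSpace ℝ (Fin n))
    (I : ℕ → Finset (Fin N)) (hI : EssentiallyCyclic I)
    (s : ℕ → Fin N → EuclideanSpace ℝ (Fin n)) (shat z : ℕ → EuclideanSpace ℝ (Fin n))
    (hrun : IsFinitoRun f g γ xinit I s shat z) :
    ∃ zstar : EuclideanSpace ℝ (Fin n),
      IsStationaryPoint (finiteSumCost f g) zstar ∧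
      Tendsto z atTop (𝓝 zstar) ∧
      (θ ≤ 1 / 2 → RLinearConvergence z zstar) := by
  obtain ⟨T, hT, hcyc⟩ := hI
  set x := lastEval I xinit z with hx
  set V := lyapunov f g γ I xinit z with hV
  set Φ : ℕ → ℝ := fun k => smoothPart f (z k) + (g (z k)).toReal with hΦ
  set c := 1 / (2 * gammaHat γ) with hc
  set d : ℕ → ℝ := fun k => ‖z (k + 1) - z k‖ with hd
  set δ : ℕ → ℝ := fun k => ∑ j ∈ Finset.range T, d (k + j) with hδ
  have hc0 : 0 < c := by have := gammaHat_pos hN hγ0; positivity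
  have hzt : ∀ k, g (z k) ≠ ⊤ := fun k => ne_top_of_mem_prox hg_proper (hrun.z_mem k)
  have hφz : ∀ k, finiteSumCost f g (z k) = (Φ k : EReal) := fun k => by
    rw [finiteSumCost_eq, hΦ, EReal.coe_add, EReal.coe_toReal (hzt k) (hg_proper.1 _)]
  have hd0 : ∀ k, 0 ≤ d k := fun k => norm_nonneg _
  have hδ0 : ∀ k, 0 ≤ δ k := fun k => Finset.sum_nonneg fun j _ => hd0 _
  have hdecV : ∀ k, V (k + 1) + c * d k ^ 2 ≤ V k :=
    hrun.lyapunov_succ_add_sq_le hN hf hL hγ0 hγ hg_proper hg_convex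
  have hmin : ∀ k u, g u ≠ ⊤ → V k ≤ (g u).toReal + surrogate f γ (x k) u :=
    fun k u hu => hrun.lyapunov_le hN hγ0 hg_proper hg_convex k hu
  have hΦV : ∀ k, Φ k ≤ V k := fun k => by
    have := smoothPart_le_surrogate hf hL hγ0 hN hγ (x k) (z k)
    simp only [hΦ, hV, lyapunov]
    linarith
  have hanti : Antitone V := antitone_nat_of_succ_le fun k => by
    nlinarith [hdecV k, mul_nonneg hc0.le (sq_nonneg (d k))]
  -- The iterates stay in a sublevel set of the cost, hence in a ball, where the cost is bounded
  -- below.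
  obtain ⟨R, hR⟩ := hcoercive.exists_norm_lt (V 0)
  have hzR : ∀ k, z k ∈ Metric.closedBall (0 : EuclideanSpace ℝ (Fin n)) R := fun k => by
    rw [mem_closedBall_zero_iff]
    refine (hR _ ?_).le
    rw [hφz, EReal.coe_le_coe_iff]
    exact (hΦV k).trans (hanti (Nat.zero_le k))
  have hcomp := isCompact_closedBall (0 : EuclideanSpace ℝ (Fin n)) R
  obtain ⟨b, hb⟩ := exists_forall_le_add_toReal hcomp (continuous_smoothPart hf) hg_proper.1 hg_lsc
  have hbV : ∀ k, b ≤ V k := fun k => (hb _ (hzR k) (hzt k)).trans (hΦV k)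
  obtain ⟨v, hVv⟩ : ∃ v, Tendsto V atTop (𝓝 v) :=
    ⟨_, tendsto_atTop_ciInf hanti ⟨b, by rintro _ ⟨k, rfl⟩; exact hbV k⟩⟩
  have hE0 : ∀ k, 0 ≤ V k - v := fun k => sub_nonneg.2 (hanti.le_of_tendsto hVv k)
  have hdec : ∀ k, (V (k + 1) - v) + c * d k ^ 2 ≤ V k - v := fun k => by linarith [hdecV k]
  have hdlim : Tendsto d atTop (𝓝 0) := by
    have h1 : Tendsto (fun k => √((V k - v) / c)) atTop (𝓝 0) := by
      simpa using ((hVv.sub_const v).div_const c).sqrt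
    refine squeeze_zero hd0 (fun k => ?_) h1
    refine Real.le_sqrt_of_sq_le ?_
    rw [le_div_iff₀ hc0]
    linarith [hdec k, hE0 (k + 1)]
  have hδlim : Tendsto δ atTop (𝓝 0) := by
    have : Tendsto δ atTop (𝓝 (∑ j ∈ Finset.range T, (0 : ℝ))) :=
      tendsto_finsetSum _ fun j _ => hdlim.comp (tendsto_add_atTop_nat j)
    simpa using this
  have hxδ : ∀ k i, ‖z (k + T) - x (k + T) i‖ ≤ δ k := norm_sub_lastEval_le hcyc xinit z
  have hzx : ∀ i, Tendsto (fun k => z k - x k i) atTop (𝓝 0) := fun i => by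
    refine (tendsto_add_atTop_iff_nat T).1 ?_
    exact squeeze_zero_norm (fun k => hxδ k i) hδlim
  have hcluster : ∀ w, MapClusterPt w atTop z →
      finiteSumCost f g w = (v : EReal) ∧ IsStationaryPoint (finiteSumCost f g) w := by
    intro w hw
    obtain ⟨ψ, hψ, hzψ⟩ := hw.tendsto_subseq
    refine isStationaryPoint_of_tendsto hf hL hγ0 hg_proper.1 hg_lsc (x := x ∘ ψ) hzψ
      (fun i => ?_) (fun k => hzt _) (hVv.comp hψ.tendsto_atTop) fun k => hmin _
    simpa using hzψ.sub ((hzx i).comp hψ.tendsto_atTop)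
  set A := ∑ i, (1 / (N : ℝ) * (L i / 2) + 1 / (2 * γ i)) with hA
  set B := ∑ i, (1 / (N : ℝ) * (L i : ℝ) + (γ i)⁻¹) with hB
  have hA0 : 0 ≤ A := Finset.sum_nonneg fun i _ => by have := hγ0 i; positivity
  have hB0 : 0 ≤ B := Finset.sum_nonneg fun i _ => by have := hγ0 i; positivity
  set σ := max θ (1 / 2) with hσ
  have hσ0 : 0 ≤ σ := hθ0.le.trans (le_max_left _ _)
  have hσ1 : σ < 1 := max_lt hθ1 (by norm_num)
  -- The error bound holds near each cluster point, and trivially near any other point, so that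
  -- compactness makes it uniform.
  have herr : ∃ C : ℝ, 0 ≤ C ∧ ∀ᶠ k in atTop,
      z (k + T) ∈ Metric.closedBall (0 : EuclideanSpace ℝ (Fin n)) R →
      (V (k + T) - v) ^ σ ≤ C * δ k := by
    refine hcomp.induction_on (p := fun S => ∃ C : ℝ, 0 ≤ C ∧ ∀ᶠ k in atTop, z (k + T) ∈ S →
      (V (k + T) - v) ^ σ ≤ C * δ k) ⟨0, le_rfl, by simp⟩ ?_ ?_ ?_
    · rintro S S' hS ⟨C, hC, h⟩
      exact ⟨C, hC, h.mono fun k hk hz => hk (hS hz)⟩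
    · rintro S S' ⟨C, hC, h⟩ ⟨C', hC', h'⟩
      refine ⟨C + C', add_nonneg hC hC', ?_⟩
      filter_upwards [h, h'] with k hk hk' hz
      rw [add_mul]
      rcases hz with hz | hz
      · exact (hk hz).trans (le_add_of_nonneg_right (mul_nonneg hC' (hδ0 k)))
      · exact (hk' hz).trans (le_add_of_nonneg_left (mul_nonneg hC (hδ0 k)))
    · intro w _
      by_cases hw : MapClusterPt w atTop z
      · obtain ⟨hwv, hws⟩ := hcluster w hw
        obtain ⟨ε, η, C, hε, hη, hC, hbound⟩ :=
          (hKL w ⟨0, regularSubdiff_subset_subdiff _ _ hws⟩).exists_rpow_le hθ1 hwv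
        refine ⟨Metric.ball w ε, mem_nhdsWithin_of_mem_nhds (Metric.ball_mem_nhds w hε),
          C * B + A ^ σ, by positivity, ?_⟩
        have hη1 : ∀ᶠ k in atTop, V (k + T) < v + min η 1 :=
          (hVv.comp (tendsto_add_atTop_nat T)).eventually
            (gt_mem_nhds (lt_add_of_pos_right v (lt_min hη one_pos)))
        filter_upwards [hη1, hδlim.eventually (gt_mem_nhds one_pos)] with k hk hk1 hz
        have hΦk := hΦV (k + T)
        have hVΦ : V (k + T) ≤ Φ (k + T) + A * δ k ^ 2 := by
          have := surrogate_le_smoothPart_add hf hL hγ0 (hxδ k)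
          simp only [hΦ, hV, lyapunov]
          linarith
        refine rpow_max_half_le (a := Φ (k + T) - v) (hE0 _) ?_ hA0 (mul_nonneg hC hB0) (hδ0 k)
          hk1.le ?_ hθ0 hθ1 fun hpos => ?_
        · linarith [le_max_left (Φ (k + T) - v) 0]
        · linarith [min_le_right η 1]
        · have hsub := surrogateResidual_mem_regularSubdiff hf hL hγ0 hg_proper.1 (hzt (k + T))
            (hmin (k + T))
          have h1 := hbound (z (k + T)) (Φ (k + T)) _ (hφz _)
            (regularSubdiff_subset_subdiff _ _ hsub) (mem_ball_iff_norm.1 hz) (by linarith)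
            (by linarith [min_le_left η 1])
          have h2 := norm_surrogateResidual_le hL hγ0 (hxδ k)
          rw [mul_assoc]
          exact h1.trans (by gcongr)
      · rw [mapClusterPt_iff_frequently] at hw
        push Not at hw
        obtain ⟨U, hU, hUz⟩ := hw
        refine ⟨U, mem_nhdsWithin_of_mem_nhds hU, 0, le_rfl, ?_⟩
        filter_upwards [(tendsto_add_atTop_nat T).eventually hUz] with k hk hz
        exact absurd hz hk
  obtain ⟨C, hC, herr⟩ := herr
  have herr' : ∀ᶠ k in atTop, (V (k + T) - v) ^ σ ≤ C * ∑ j ∈ Finset.range T, d (k + j) :=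
    herr.mono fun k hk => hk (hzR _)
  have hdist : ∀ k, dist (z k) (z (k + 1)) = d k := fun k => by rw [dist_comm, dist_eq_norm]
  have hsum := summable_of_decrease_of_rpow_le hE0 hd0 hc0 hdec hσ0 hσ1 hC hT herr'
  obtain ⟨zstar, hzstar⟩ := cauchySeq_tendsto_of_complete
    (cauchySeq_of_summable_dist (hsum.congr fun k => (hdist k).symm))
  refine ⟨zstar, (hcluster zstar hzstar.mapClusterPt).2, hzstar, fun hθ => ?_⟩
  rw [hσ, max_eq_right hθ] at herr'
  obtain ⟨D, ρ, hD, hρ0, hρ1, hgeo⟩ :=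
    exists_geometric_bound_of_decrease_of_sqrt_le hE0 hd0 hc0 hdec hT herr'
  refine ⟨D / (1 - ρ), ρ, div_nonneg hD (by linarith), hρ0, hρ1, fun k => ?_⟩
  rw [← dist_eq_norm, div_mul_eq_mul_div]
  exact dist_le_of_le_geometric_of_tendsto ρ D hρ1 (fun k => (hdist k).trans_le (hgeo k)) hzstar k
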